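/- Let $n \ge 0$ and $r > 0$, and define \[ S_{\mathrm{lat},n} = \big\{ (x,y) \in \mathbb{R}^n \times \mathbb{R}^n : |x|,\,|y|,\,|x+y|,\,|x-y| \in \{0\} \cup [r,\infty)\big\}. \] Normalize the Fourier transform by $\widehat f(u,v) = \int_{\mathbb{R}^n \times \mathbb{R}^n} f(x,y)\, e^{-2\pi i (\langle x,u\rangle + \langle y,v\rangle)}\, dx\, dy$. Suppose $f \colon \mathbb{R}^{n} \times \mathbb{R}^n \to \mathbb{R}$ is a continuous, integrable function such that $\widehat f$ is real-valued and nonnegative everywhere, $\widehat f(0,0)=1$, and \[ f(x,y) \le 0 \quad\text{for all } (x,y) \in S_{\mathrm{lat},n} \setminus \{(0,0)\}. \] Then \[ \mathrm{vol}(B_{r/2}^n)\, \sqrt{f(0,0)} \] is an upper bound on the optimal lattice sphere packing density in $\mathbb{R}^n$, where $B_{r/2}^n$ is the closed ball of radius $r/2$ in $\mathbb{R}^n$. Here a lattice sphere packing is a union $P = \bigcup_{x \in \Lambda} (x + B_\rho^n)$ of balls of some radius $\rho > 0$ with pairwise disjoint interiors, where $\Lambda$ is a lattice in $\mathbb{R}^n$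 (a discrete subgroup that spans $\mathbb{R}^n$). Its density is $\limsup_{R \to \infty} \mathrm{vol}(P \cap B_R^n)/\mathrm{vol}(B_R^n)$, and the optimal lattice sphere packing density is the supremum of these densities over all $\Lambda$ and $\rho$. -/

import Mathlib

open MeasureTheory Metric Filter
open scoped FourierTransform ENNReal

/-- Euclidean space `ℝⁿ`. -/
abbrev Rn (n : ℕ) : Type := EuclideanSpace ℝ (Fin n)

/-- `ℝⁿ × ℝⁿ` with its Euclidean structure: `⟪(x, y), (u, v)⟫ = ⟪x, u⟫ + ⟪y, v⟫`. -/
abbrev RnPair (n : ℕ) : Type := WithLp 2 (Rn n × Rn n)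

/-- The pairs `(x, y)` for which each of `|x|`, `|y|`, `|x + y|`, `|x - y|` is `0` or at least
`r`. -/
def SLat (n : ℕ) (r : ℝ) : Set (RnPair n) :=
  {p | ‖p.fst‖ ∈ ({0} ∪ Set.Ici r : Set ℝ) ∧ ‖p.snd‖ ∈ ({0} ∪ Set.Ici r : Set ℝ) ∧
    ‖p.fst + p.snd‖ ∈ ({0} ∪ Set.Ici r : Set ℝ) ∧ ‖p.fst - p.snd‖ ∈ ({0} ∪ Set.Ici r : Set ℝ)}

/-- `Λ` is the set of centers of a lattice sphere packing in `ℝⁿ` by spheres of radius `ρ`: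
`Λ` is a discrete subgroup that spans `ℝⁿ`, and the closed balls of radius `ρ > 0` about the
points of `Λ` have pairwise disjoint interiors. -/
structure IsLatticePacking (n : ℕ) (Λ : Submodule ℤ (Rn n)) (ρ : ℝ) : Prop where
  discrete : DiscreteTopology Λ
  span_top : Submodule.span ℝ (Λ : Set (Rn n)) = ⊤
  radius_pos : 0 < ρ
  disjoint : (Λ : Set (Rn n)).Pairwise fun x y => Disjoint (ball x ρ) (ball y ρ)

/-- The (upper) density of a subset of `ℝⁿ`: the asymptotic fraction of the volume of a large
ball about the origin which is covered by the set. -/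
noncomputable def upperDensity (n : ℕ) (A : Set (Rn n)) : ℝ≥0∞ :=
  limsup (fun R : ℝ => volume (A ∩ ball 0 R) / volume (ball (0 : Rn n) R)) atTop

/-- The optimal lattice sphere packing density in `ℝⁿ`: the supremum, over all lattice sphere
packings by congruent spheres, of the density of the union of the balls. -/
noncomputable def latticePackingDensity (n : ℕ) : ℝ≥0∞ :=
  ⨆ (Λ : Submodule ℤ (Rn n)) (ρ : ℝ) (_ : IsLatticePacking n Λ ρ),
    upperDensity n (⋃ x ∈ Λ, closedBall x ρ)

/-!
Why the bound holds. Fix a lattice packing and rescale it so that nonzero lattice vectors have norm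
at least `r`. Then `Λ × Λ` lies in `SLat n r`, because `x ± y` are lattice vectors when `x` and `y`
are, so `f ≤ 0` on the differences of distinct points of `Λ × Λ`. Poisson summation would now give
`f 0 ≥ ∑ f ≥ 1 / covol(Λ) ^ 2`, but `f` is not known to be summable over a lattice, so the argument
uses positive definiteness instead and involves neither covolumes nor dual lattices.

* Since `f` is continuous and `𝓕 f ≥ 0`, Gaussian summation and Fatou's lemma make `𝓕 f` integrable
  (`integrable_fourier_of_nonneg`). By Fourier inversion the quadratic form `∬ f (x - y)` on signed
  measures is nonnegative (`quadratic_form_nonneg`).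
* Apply it to `∑_{p ∈ A} δ_p - c • (volume on B)`, where `A = (Λ × Λ) ∩ B₀` and the window `B` is
  `B₀` thickened by a constant `T`. The diagonal of the first term gives `#A * f 0`, and all the
  other pairs contribute at most `0`. The cross term and the last term are `#A` and `vol B` up to a
  small relative error, since `∫ f = 𝓕 f 0 = 1`. With `c = #A / vol B` this becomes
  `#A / vol B ≤ (1 + o(1)) * f 0` (`card_mul_le_of_sub_nonpos`).
* For `B₀` a product of two balls of radius `R`, both sides are squares, and the square root bounds
  the number of points of `Λ` per unit volume by `(1 + o(1)) * √(f 0)` (`exists_mul_card_le`).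
  Multiplying by the volume of one ball bounds the density
  (`IsLatticePacking.upperDensity_le_mul`).
-/

/-! ### Positive definiteness from a nonnegative Fourier transform -/

section FourierPositive

open Real Complex Module
open scoped RealInnerProductSpace ComplexConjugate Topology

variable {V : Type*} [NormedAddCommGroup V] [InnerProductSpace ℝ V]
  [MeasurableSpace V] [BorelSpace V] [FiniteDimensional ℝ V]

/-- The Gaussian means of `𝓕 f` converge to `f 0`, whether or not `𝓕 f` is integrable. -/
lemma tendsto_integral_gaussian_mul_fourier {f : V → ℂ} (hf : Integrable f)
    (hc : ContinuousAt f 0) :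
    Tendsto (fun c : ℝ => ∫ w : V, cexp (-c⁻¹ * ‖w‖ ^ 2) • 𝓕 f w) atTop (𝓝 (f 0)) := by
  refine (Real.tendsto_integral_gaussian_smul' hf hc).congr' ?_
  filter_upwards [Ioi_mem_atTop 0] with c (hc : 0 < c)
  have J : Integrable (fun w : V => cexp (-c⁻¹ * ‖w‖ ^ 2 + 2 * π * I * ⟪(0 : V), w⟫)) :=
    GaussianFourier.integrable_cexp_neg_mul_sq_norm_add (by simpa) _ _
  have h := VectorFourier.integral_fourierIntegral_smul_eq_flip (L := innerₗ V)
      Real.continuous_fourierChar continuous_inner J hf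
  have h' : ∫ w : V, 𝓕 (fun w : V => cexp (-c⁻¹ * ‖w‖ ^ 2 + 2 * π * I * ⟪(0 : V), w⟫)) w • f w
      = ∫ w : V, cexp (-c⁻¹ * ‖w‖ ^ 2) • 𝓕 f w := by
    simpa using! h
  rw [← h']
  congr with w
  rw [fourier_gaussian_innerProductSpace' (by simpa)]
  congr 2
  · simp
  · congr 1
    simp only [ofReal_inv, div_inv_eq_mul]
    ring

/-- A continuous integrable function with nonnegative Fourier transform has an integrable Fourier
transform: the Gaussian means of `𝓕 f` stay bounded, so Fatou's lemma applies. -/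
lemma integrable_fourier_of_nonneg {f : V → ℂ} (hf : Integrable f) (hc : Continuous f)
    (h0 : ∀ w, 0 ≤ (𝓕 f w).re ∧ (𝓕 f w).im = 0) : Integrable (𝓕 f) := by
  have hcont : Continuous (𝓕 f) :=
    VectorFourier.fourierIntegral_continuous Real.continuous_fourierChar
      (by exact continuous_inner) hf
  have hre : ∀ w, 𝓕 f w = ((𝓕 f w).re : ℂ) := fun w => by
    apply Complex.ext <;> simp [(h0 w).2]
  refine ⟨hcont.aestronglyMeasurable, ?_⟩
  have hlim := (tendsto_integral_gaussian_mul_fourier hf hc.continuousAt).comp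
    (tendsto_natCast_atTop_atTop (R := ℝ))
  obtain ⟨N, hN⟩ : ∃ N : ℕ, ∀ k ≥ N, ∫⁻ w : V,
      ENNReal.ofReal (rexp (-(k : ℝ)⁻¹ * ‖w‖ ^ 2) * (𝓕 f w).re) ≤
        ENNReal.ofReal (‖f 0‖ + 1) := by
    have := (hlim.norm.eventually_lt_const (lt_add_one ‖f 0‖)).and (eventually_gt_atTop 0)
    obtain ⟨N, hN⟩ := eventually_atTop.1 this
    refine ⟨N, fun k hk => ?_⟩
    obtain ⟨h1, h2⟩ := hN k hk
    have hk0 : (0 : ℝ) < (k : ℝ)⁻¹ := by positivity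
    have hint : Integrable (fun w : V => rexp (-(k : ℝ)⁻¹ * ‖w‖ ^ 2) * (𝓕 f w).re) := by
      have hg : Integrable (fun w : V => rexp (-(k : ℝ)⁻¹ * ‖w‖ ^ 2)) := by
        have := (GaussianFourier.integrable_cexp_neg_mul_sq_norm_add (V := V)
          (b := ((k : ℝ)⁻¹ : ℝ)) (by simpa using h2) 0 0).norm
        refine this.congr (ae_of_all _ fun w => ?_)
        simp [Complex.norm_exp, ← Complex.ofReal_pow]
      refine hg.mul_bdd (c := ∫ v, ‖f v‖) ?_ (ae_of_all _ fun w => ?_)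
      · exact (Complex.continuous_re.comp hcont).aestronglyMeasurable
      · exact (Complex.abs_re_le_norm _).trans
          (VectorFourier.norm_fourierIntegral_le_integral_norm _ _ _ _ _)
    rw [← ofReal_integral_eq_lintegral_ofReal hint
      (ae_of_all _ fun w => mul_nonneg (Real.exp_pos _).le (h0 w).1)]
    refine ENNReal.ofReal_le_ofReal ?_
    refine le_trans ?_ h1.le
    refine le_trans (le_abs_self _) (le_of_eq ?_)
    rw [← Real.norm_eq_abs, ← Complex.norm_real, ← integral_complex_ofReal]
    congr 2
    ext w
    rw [hre w]
    simp
  have hfatou := lintegral_liminf_le (μ := (volume : Measure V)) (u := atTop)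
    (f := fun (k : ℕ) w => ENNReal.ofReal (rexp (-(k : ℝ)⁻¹ * ‖w‖ ^ 2) * (𝓕 f w).re))
    (fun k => by
      have : Continuous fun w => (𝓕 f w).re := Complex.continuous_re.comp hcont
      exact (ENNReal.continuous_ofReal.comp (by fun_prop)).measurable)
  have hpt : ∀ w : V, liminf (fun k : ℕ =>
      ENNReal.ofReal (rexp (-(k : ℝ)⁻¹ * ‖w‖ ^ 2) * (𝓕 f w).re)) atTop = ‖𝓕 f w‖ₑ := by
    intro w
    have h1 : ‖𝓕 f w‖ₑ = ENNReal.ofReal (rexp (-0 * ‖w‖ ^ 2) * (𝓕 f w).re) := by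
      rw [← ofReal_norm]
      nth_rewrite 1 [hre w]
      simp [abs_of_nonneg (h0 w).1]
    rw [h1]
    refine Tendsto.liminf_eq (ENNReal.tendsto_ofReal ?_)
    refine Tendsto.mul_const _ ((Real.continuous_exp.tendsto _).comp ?_)
    exact (tendsto_inv_atTop_nhds_zero_nat.neg).mul_const _
  simp_rw [hpt] at hfatou
  refine lt_of_le_of_lt hfatou (lt_of_le_of_lt ?_ (ENNReal.ofReal_lt_top (r := ‖f 0‖ + 1)))
  exact liminf_le_of_le (by isBoundedDefault) fun b hb => by
    obtain ⟨M, hM⟩ := eventually_atTop.1 hb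
    exact (hM _ (le_max_left M N)).trans (hN _ (le_max_right M N))

/-- For finite measures `μ`, `ν`, pairing `f (x - y)` with `μ ⊗ ν` amounts to pairing `𝓕 f` with
the product of the characteristic functions. Mathlib's `charFun` has no `2π` in the exponent, which
is why the frequency is rescaled. -/
lemma integral_sub_prod_eq {f : V → ℂ} (hf : Integrable f) (hc : Continuous f)
    (hF : Integrable (𝓕 f)) (μ ν : Measure V) [IsFiniteMeasure μ] [IsFiniteMeasure ν] :
    ∫ z : V × V, f (z.1 - z.2) ∂(μ.prod ν) =
      ∫ w, 𝓕 f w * (charFun μ ((2 * π) • w) * conj (charFun ν ((2 * π) • w))) := by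
  have hinv : ∀ x, f x = ∫ w, cexp (2 * π * ⟪w, x⟫ * I) * 𝓕 f w := fun x => by
    conv_lhs => rw [← hc.fourierInv_fourier_eq hf hF]
    rw [Real.fourierInv_eq']
    simp
  simp_rw [hinv]
  rw [integral_integral_swap]
  · congr with w
    rw [integral_mul_const, mul_comm]
    congr 1
    rw [← charFun_neg, charFun_apply, charFun_apply, ← integral_prod_mul]
    congr with z
    rw [← Complex.exp_add]
    congr 1
    simp only [inner_sub_right, inner_smul_right, inner_neg_right, real_inner_comm w]
    push_cast
    ring
  · refine Integrable.mono' (g := fun z => ‖𝓕 f z.2‖) ?_ ?_ ?_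
    · exact hF.norm.comp_snd _
    · refine AEStronglyMeasurable.mul ?_ (hF.aestronglyMeasurable.comp_snd)
      exact Continuous.aestronglyMeasurable (by fun_prop)
    · refine ae_of_all _ fun z => ?_
      simp only [Function.uncurry, norm_mul]
      have : ‖cexp (2 * π * ⟪z.2, z.1.1 - z.1.2⟫ * I)‖ = 1 := by
        have := Complex.norm_exp_ofReal_mul_I (2 * π * ⟪z.2, z.1.1 - z.1.2⟫)
        simpa using this
      rw [this, one_mul]

/-- A function with nonnegative Fourier transform is positive definite: the quadratic form
`∬ f (x - y)` is nonnegative on the signed measure `μ - c ν`. -/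
lemma quadratic_form_nonneg {f : V → ℝ} (hf : Integrable f) (hc : Continuous f)
    (h0 : ∀ w, 0 ≤ (𝓕 (fun x => (f x : ℂ)) w).re ∧ (𝓕 (fun x => (f x : ℂ)) w).im = 0)
    (μ ν : Measure V) [IsFiniteMeasure μ] [IsFiniteMeasure ν] (c : ℝ) :
    0 ≤ ∫ z : V × V, f (z.1 - z.2) ∂(μ.prod μ) - 2 * c * ∫ z : V × V, f (z.1 - z.2) ∂(μ.prod ν)
      + c ^ 2 * ∫ z : V × V, f (z.1 - z.2) ∂(ν.prod ν) := by
  set F : V → ℂ := fun x => (f x : ℂ) with hFdef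
  have hfC : Integrable F := hf.ofReal
  have hcC : Continuous F := Complex.continuous_ofReal.comp hc
  have hF := integrable_fourier_of_nonneg hfC hcC h0
  have key : ∀ μ ν : Measure V, IsFiniteMeasure μ → IsFiniteMeasure ν →
      Integrable (fun w => (𝓕 F w).re *
        (charFun μ ((2 * π) • w) * conj (charFun ν ((2 * π) • w))).re) ∧
      ∫ z : V × V, f (z.1 - z.2) ∂(μ.prod ν) = ∫ w, (𝓕 F w).re *
        (charFun μ ((2 * π) • w) * conj (charFun ν ((2 * π) • w))).re := by
    intro μ ν _ _
    have h1 := integral_sub_prod_eq hfC hcC hF μ ν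
    have hm : ∀ μ : Measure V, IsFiniteMeasure μ →
        AEStronglyMeasurable (fun w => charFun μ ((2 * π) • w)) (volume : Measure V) :=
      fun μ _ => ((measurable_charFun (μ := μ)).comp
        (measurable_const_smul (2 * π))).aestronglyMeasurable
    have hi : Integrable (fun w => 𝓕 F w *
        (charFun μ ((2 * π) • w) * conj (charFun ν ((2 * π) • w)))) := by
      refine hF.mul_bdd (c := μ.real Set.univ * ν.real Set.univ)
        ((hm μ ‹_›).mul (Complex.continuous_conj.comp_aestronglyMeasurable (hm ν ‹_›)))
        (ae_of_all _ fun w => ?_)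
      rw [norm_mul, RCLike.norm_conj]
      exact mul_le_mul (norm_charFun_le _) (norm_charFun_le _) (norm_nonneg _)
        measureReal_nonneg
    have hre : ∀ w, (𝓕 F w * (charFun μ ((2 * π) • w) * conj (charFun ν ((2 * π) • w)))).re =
        (𝓕 F w).re * (charFun μ ((2 * π) • w) * conj (charFun ν ((2 * π) • w))).re :=
      fun w => by rw [Complex.mul_re, (h0 w).2]; ring
    refine ⟨hi.re.congr (ae_of_all _ hre), ?_⟩
    have h2 := congrArg Complex.re h1
    rw [integral_complex_ofReal, Complex.ofReal_re] at h2
    rw [h2, ← integral_congr_ae (ae_of_all _ hre)]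
    exact (integral_re hi).symm
  obtain ⟨i1, e1⟩ := key μ μ inferInstance inferInstance
  obtain ⟨i2, e2⟩ := key μ ν inferInstance inferInstance
  obtain ⟨i3, e3⟩ := key ν ν inferInstance inferInstance
  rw [e1, e2, e3, ← integral_const_mul, ← integral_const_mul,
    ← integral_sub i1 (i2.const_mul _), ← integral_add (by exact i1.sub (i2.const_mul _)) (i3.const_mul _)]
  refine integral_nonneg fun w => ?_
  set a := charFun μ ((2 * π) • w)
  set b := charFun ν ((2 * π) • w)
  have : (𝓕 F w).re * (a * conj a).re - 2 * c * ((𝓕 F w).re * (a * conj b).re) +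
      c ^ 2 * ((𝓕 F w).re * (b * conj b).re) =
      (𝓕 F w).re * ((a.re - c * b.re) ^ 2 + (a.im - c * b.im) ^ 2) := by
    simp only [Complex.mul_re, Complex.conj_re, Complex.conj_im]
    ring
  change 0 ≤ (𝓕 F w).re * (a * conj a).re - 2 * c * ((𝓕 F w).re * (a * conj b).re) +
      c ^ 2 * ((𝓕 F w).re * (b * conj b).re)
  rw [this]
  exact mul_nonneg (h0 w).1 (by positivity)

/-- By Fourier inversion, a continuous integrable function with nonnegative Fourier transform is
bounded. -/
lemma exists_bound_of_fourier_nonneg {f : V → ℝ} (hf : Integrable f) (hc : Continuous f)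
    (h0 : ∀ w, 0 ≤ (𝓕 (fun x => (f x : ℂ)) w).re ∧ (𝓕 (fun x => (f x : ℂ)) w).im = 0) :
    ∃ C, ∀ x, ‖f x‖ ≤ C := by
  have hcC : Continuous (fun x => (f x : ℂ)) := Complex.continuous_ofReal.comp hc
  have hF := integrable_fourier_of_nonneg hf.ofReal hcC h0
  refine ⟨∫ w, ‖𝓕 (fun x => (f x : ℂ)) w‖, fun x => ?_⟩
  have h : (f x : ℂ) = 𝓕⁻ (𝓕 (fun x => (f x : ℂ))) x := by
    rw [hcC.fourierInv_fourier_eq hf.ofReal hF]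
  rw [← Complex.norm_real, h, Real.fourierInv_eq]
  refine (norm_integral_le_integral_norm _).trans (le_of_eq ?_)
  simp

end FourierPositive

/-! ### Counting points in a window -/

section Counting

open scoped Topology

variable {V : Type*} [NormedAddCommGroup V] [InnerProductSpace ℝ V]
  [MeasurableSpace V] [BorelSpace V] [FiniteDimensional ℝ V]

/-- The tails of an integrable function are small. -/
lemma exists_setIntegral_norm_le {f : V → ℝ} (hf : Integrable f) {ε : ℝ} (hε : 0 < ε) :
    ∃ T : ℝ, 0 ≤ T ∧ ∫ z in {z : V | T ≤ ‖z‖}, ‖f z‖ ≤ ε := by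
  have h := tendsto_setIntegral_of_antitone (μ := (volume : Measure V)) (f := fun z => ‖f z‖)
    (s := fun k : ℕ => {z : V | (k : ℝ) ≤ ‖z‖})
    (fun k => measurableSet_le measurable_const measurable_norm)
    (fun k l hkl z (hz : (l : ℝ) ≤ ‖z‖) => (Nat.cast_le.2 hkl).trans hz)
    ⟨0, hf.norm.integrableOn⟩
  have hempty : ⋂ k : ℕ, {z : V | (k : ℝ) ≤ ‖z‖} = ∅ := by
    ext z
    simpa using exists_nat_gt ‖z‖
  rw [hempty, setIntegral_empty] at h
  obtain ⟨k, hk⟩ := (h.eventually_le_const hε).exists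
  exact ⟨k, k.cast_nonneg, hk⟩

/-- The mass of `f (x - ·)` over a window differs from the total mass by at most the tail of `f`
when `x` is deep inside the window. -/
lemma abs_one_sub_setIntegral_le {f : V → ℝ} (hf : Integrable f) (hone : ∫ x, f x = 1)
    {B : Set V} (hB : MeasurableSet B) {T ε : ℝ} (hT : ∫ z in {z : V | T ≤ ‖z‖}, ‖f z‖ ≤ ε)
    {x : V} (hx : ∀ y ∉ B, T ≤ ‖x - y‖) : |1 - ∫ y in B, f (x - y)| ≤ ε := by
  have hfx : Integrable (fun y => f (x - y)) := hf.comp_sub_left x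
  have h1 : 1 - ∫ y in B, f (x - y) = ∫ y in Bᶜ, f (x - y) := by
    rw [← hone, ← integral_sub_left_eq_self f volume x, ← integral_add_compl hB hfx]
    ring
  rw [h1, ← Real.norm_eq_abs]
  refine (norm_integral_le_integral_norm _).trans (le_trans ?_ hT)
  have hS : MeasurableSet {z : V | T ≤ ‖z‖} := measurableSet_le measurable_const measurable_norm
  rw [← integral_indicator hS,
    ← integral_sub_left_eq_self (Set.indicator {z : V | T ≤ ‖z‖} fun z => ‖f z‖) volume x,
    ← integral_indicator hB.compl]
  refine integral_mono (hfx.norm.indicator hB.compl)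
    ((hf.norm.indicator hS).comp_sub_left x) fun y => ?_
  by_cases hy : y ∈ B
  · simpa [hy] using Set.indicator_nonneg (fun z _ => norm_nonneg (f z)) _
  · simp [hy, hx y hy]

/-- Testing positive definiteness of `f` on the point masses of `A` minus a multiple of Lebesgue
measure on a slightly larger window `B` bounds the number of points of `A`. The number `T` bounds
from below the distance between `B₀`, which contains `A`, and the outside of `B`. -/
lemma card_mul_le_of_sub_nonpos {f : V → ℝ} (hf : Integrable f) (hc : Continuous f)
    (h0 : ∀ w, 0 ≤ (𝓕 (fun x => (f x : ℂ)) w).re ∧ (𝓕 (fun x => (f x : ℂ)) w).im = 0)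
    (hone : ∫ x, f x = 1) {B₀ B : Set V} (hB₀ : MeasurableSet B₀) (hB : MeasurableSet B)
    (hsub : B₀ ⊆ B) (hfin : volume B ≠ ∞) (hpos : 0 < volume.real B) {T ε : ℝ}
    (hT : ∫ z in {z : V | T ≤ ‖z‖}, ‖f z‖ ≤ ε)
    (hsep : ∀ x ∈ B₀, ∀ y ∉ B, T ≤ ‖x - y‖) {A : Finset V} (hne : A.Nonempty)
    (hA : (A : Set V) ⊆ B₀) (hneg : ∀ p ∈ A, ∀ q ∈ A, p ≠ q → f (p - q) ≤ 0) :
    (A.card : ℝ) * ((1 - 3 * ε) * volume.real B -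
      (∫ x, ‖f x‖) * (volume.real B - volume.real B₀)) ≤ volume.real B ^ 2 * f 0 := by
  classical
  set a : ℝ := (A.card : ℝ)
  set b : ℝ := volume.real B
  set M : ℝ := ∫ x, ‖f x‖
  have ha : 0 < a := by simpa [a] using hne.card_pos
  obtain ⟨C, hC⟩ := exists_bound_of_fourier_nonneg hf hc h0
  let μ : Measure V := ∑ p ∈ A, Measure.dirac p
  let ν : Measure V := volume.restrict B
  have : IsFiniteMeasure ν := ⟨by simpa [ν] using hfin.lt_top⟩
  have hint : ∀ (μ ν : Measure V) [IsFiniteMeasure μ] [IsFiniteMeasure ν],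
      Integrable (fun z : V × V => f (z.1 - z.2)) (μ.prod ν) := fun μ ν _ _ =>
    Integrable.of_bound (Continuous.aestronglyMeasurable (by fun_prop)) C (ae_of_all _ fun _ => hC _)
  have hμ : ∀ g : V → ℝ, ∫ x, g x ∂μ = ∑ p ∈ A, g p := fun g => by
    rw [integral_finsetSum_measure fun p _ => integrable_dirac (by simp)]
    simp
  -- the multiple `a / b` minimizes `a * f 0 - 2 * c * a + c ^ 2 * b` over `c`
  have hmain := quadratic_form_nonneg hf hc h0 μ ν (a / b)
  rw [integral_prod _ (hint μ μ), integral_prod _ (hint μ ν), integral_prod _ (hint ν ν)] at hmain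
  simp only [hμ] at hmain
  have hX : ∑ p ∈ A, ∑ q ∈ A, f (p - q) ≤ a * f 0 := by
    rw [← nsmul_eq_mul]
    refine Finset.sum_le_card_nsmul _ _ _ fun p hp => ?_
    rw [← Finset.add_sum_erase _ _ hp, sub_self]
    refine add_le_of_nonpos_right (Finset.sum_nonpos fun q hq => ?_)
    exact hneg p hp q (Finset.mem_of_mem_erase hq) (Finset.ne_of_mem_erase hq).symm
  have hY : a * (1 - ε) ≤ ∑ p ∈ A, ∫ y, f (p - y) ∂ν := by
    rw [← nsmul_eq_mul]
    refine Finset.card_nsmul_le_sum _ _ _ fun p hp => ?_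
    have := abs_le.1 (abs_one_sub_setIntegral_le hf hone hB hT (hsep p (hA hp)))
    linarith [this.2]
  have hε : 0 ≤ ε := (integral_nonneg fun _ => norm_nonneg _).trans hT
  have hM : 0 ≤ M := integral_nonneg fun _ => norm_nonneg _
  have hZ : ∫ x, ∫ y, f (x - y) ∂ν ∂ν ≤ (1 + ε) * b + M * (b - volume.real B₀) := by
    have hle : ∀ x, ∫ y, f (x - y) ∂ν ≤ (1 + ε) + Set.indicator B₀ᶜ (fun _ => M) x := by
      intro x
      by_cases hx : x ∈ B₀
      · have := abs_le.1 (abs_one_sub_setIntegral_le hf hone hB hT (hsep x hx))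
        simp only [Set.mem_compl_iff, hx, not_true_eq_false, not_false_eq_true,
          Set.indicator_of_notMem]
        linarith [this.1]
      · have h1 : ∫ y in B, f (x - y) ≤ M := calc
          ∫ y in B, f (x - y) ≤ ‖∫ y in B, f (x - y)‖ := le_abs_self _
          _ ≤ ∫ y in B, ‖f (x - y)‖ := norm_integral_le_integral_norm _
          _ ≤ ∫ y, ‖f (x - y)‖ := setIntegral_le_integral (hf.comp_sub_left x).norm
              (ae_of_all _ fun _ => norm_nonneg _)
          _ = M := integral_sub_left_eq_self (fun z => ‖f z‖) volume x
        simp only [Set.mem_compl_iff, hx, not_false_eq_true, Set.indicator_of_mem]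
        linarith
    calc ∫ x, ∫ y, f (x - y) ∂ν ∂ν
        ≤ ∫ x, ((1 + ε) + Set.indicator B₀ᶜ (fun _ => M) x) ∂ν :=
          integral_mono (hint ν ν).integral_prod_left
            ((integrable_const _).add ((integrable_const _).indicator hB₀.compl)) hle
      _ = (1 + ε) * b + M * (b - volume.real B₀) := by
          rw [integral_add (integrable_const _) ((integrable_const _).indicator hB₀.compl),
            integral_indicator_const _ hB₀.compl]
          have : ν.real B₀ᶜ = b - volume.real B₀ := by
            simp only [ν, b]
            rw [measureReal_restrict_apply hB₀.compl, Set.inter_comm, ← Set.sdiff_eq,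
              measureReal_sdiff hsub hB₀ hfin]
          rw [this]
          simp [ν, b, mul_comm]
  have hq : 0 ≤ a * f 0 - 2 * (a / b) * (a * (1 - ε)) +
      (a / b) ^ 2 * ((1 + ε) * b + M * (b - volume.real B₀)) := by
    have h2 : 0 ≤ 2 * (a / b) := by positivity
    nlinarith [mul_le_mul_of_nonneg_left hY h2, mul_le_mul_of_nonneg_left hZ (sq_nonneg (a / b))]
  have hscale : b ^ 2 / a * (a * f 0 - 2 * (a / b) * (a * (1 - ε)) +
      (a / b) ^ 2 * ((1 + ε) * b + M * (b - volume.real B₀))) =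
      b ^ 2 * f 0 - a * ((1 - 3 * ε) * b - M * (b - volume.real B₀)) := by
    field_simp
    ring
  have := mul_nonneg (by positivity : 0 ≤ b ^ 2 / a) hq
  rw [hscale] at this
  linarith

end Counting

/-! ### Windows in `ℝⁿ × ℝⁿ` -/

section PairWindow

open scoped Topology

variable {n : ℕ}

/-- The window of pairs `(x, y)` with `|x| < R` and `|y| < R`. -/
def pairWindow (n : ℕ) (R : ℝ) : Set (RnPair n) :=
  (WithLp.ofLp : RnPair n → Rn n × Rn n) ⁻¹' (ball 0 R ×ˢ ball 0 R)

lemma mem_pairWindow {R : ℝ} {p : RnPair n} : p ∈ pairWindow n R ↔ ‖p.fst‖ < R ∧ ‖p.snd‖ < R := by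
  simp only [pairWindow, Set.mem_preimage, Set.mem_prod, mem_ball_zero_iff]
  rfl

lemma measurableSet_pairWindow (R : ℝ) : MeasurableSet (pairWindow n R) :=
  (WithLp.volume_preserving_ofLp (Rn n) (Rn n)).measurable
    (measurableSet_ball.prod measurableSet_ball)

lemma volume_pairWindow (R : ℝ) :
    volume (pairWindow n R) = volume (ball (0 : Rn n) R) ^ 2 := by
  rw [pairWindow, (WithLp.volume_preserving_ofLp (Rn n) (Rn n)).measure_preimage
    (measurableSet_ball.prod measurableSet_ball).nullMeasurableSet, Measure.volume_eq_prod,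
    Measure.prod_prod, sq]

lemma volume_real_pairWindow (R : ℝ) :
    volume.real (pairWindow n R) = volume.real (ball (0 : Rn n) R) ^ 2 := by
  simp [measureReal_def, volume_pairWindow]

lemma volume_real_ball_of_pos {R : ℝ} (hR : 0 < R) :
    volume.real (ball (0 : Rn n) R) = R ^ n * volume.real (ball (0 : Rn n) 1) := by
  rw [measureReal_def, Measure.addHaar_ball_of_pos _ _ hR, ENNReal.toReal_mul,
    ENNReal.toReal_ofReal (by positivity), finrank_euclideanSpace_fin, measureReal_def]

lemma volume_real_ball_pos {R : ℝ} (hR : 0 < R) : 0 < volume.real (ball (0 : Rn n) R) :=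
  ENNReal.toReal_pos (measure_ball_pos _ _ hR).ne' measure_ball_lt_top.ne

/-- A finite set `A ⊆ ℝⁿ` such that the differences of `A × A` lie in `SLat n r` has at most
`(1 + o(1)) √(f 0)` points per unit volume. -/
lemma exists_mul_card_le {r : ℝ} {f : RnPair n → ℝ} (hc : Continuous f) (hf : Integrable f)
    (h0 : ∀ w, 0 ≤ (𝓕 (fun x => (f x : ℂ)) w).re ∧ (𝓕 (fun x => (f x : ℂ)) w).im = 0)
    (hone : ∫ x, f x = 1) (hneg : ∀ p ∈ SLat n r \ {0}, f p ≤ 0) {θ : ℝ} (hθ0 : 0 < θ)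
    (hθ1 : θ < 1) :
    ∃ T : ℝ, ∀ᶠ R : ℝ in atTop, ∀ A : Finset (Rn n), (A : Set (Rn n)) ⊆ ball 0 R →
      (∀ x ∈ A, ∀ x' ∈ A, ∀ y ∈ A, ∀ y' ∈ A, WithLp.toLp 2 (x - x', y - y') ∈ SLat n r) →
      θ * A.card ≤ volume.real (ball (0 : Rn n) (R + T)) * √(f 0) := by
  -- three errors `ε` come from the tail of `f`, and one from the boundary layer of the window
  set ε : ℝ := (1 - θ ^ 2) / 4
  have hε : 0 < ε := by
    have : θ ^ 2 < 1 := by nlinarith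
    simp only [ε]; linarith
  obtain ⟨T, hT0, hT⟩ := exists_setIntegral_norm_le hf hε
  set M : ℝ := ∫ x, ‖f x‖
  refine ⟨T, ?_⟩
  have hlim : Tendsto (fun R : ℝ => M * (1 - (R / (R + T)) ^ (2 * n))) atTop (𝓝 0) := by
    have h1 : Tendsto (fun R : ℝ => R / (R + T)) atTop (𝓝 1) := by
      have h2 : Tendsto (fun R : ℝ => 1 - T / (R + T)) atTop (𝓝 (1 - 0)) :=
        ((tendsto_atTop_add_const_right atTop T tendsto_id).const_div_atTop T).const_sub 1
      rw [sub_zero] at h2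
      refine h2.congr' ?_
      filter_upwards [eventually_gt_atTop 0] with R hR
      have : R + T ≠ 0 := by positivity
      field_simp
      ring
    simpa using ((h1.pow (2 * n)).const_sub 1).const_mul M
  filter_upwards [hlim.eventually_le_const hε, eventually_gt_atTop 0] with R hR hR0 A hA hS
  rcases A.eq_empty_or_nonempty with rfl | hne
  · simp only [Finset.card_empty, Nat.cast_zero, mul_zero]
    positivity
  classical
  set v : ℝ := volume.real (ball (0 : Rn n) (R + T)) with hv
  have hvpos : 0 < v := volume_real_ball_pos (by positivity)
  have hb := volume_real_pairWindow (n := n) (R + T)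
  have hkey := card_mul_le_of_sub_nonpos (B₀ := pairWindow n R) (B := pairWindow n (R + T))
    (A := (A ×ˢ A).image (WithLp.toLp 2)) hf hc h0 hone (measurableSet_pairWindow _)
    (measurableSet_pairWindow _)
    (fun p hp => mem_pairWindow.2 ⟨(mem_pairWindow.1 hp).1.trans_le (by linarith),
      (mem_pairWindow.1 hp).2.trans_le (by linarith)⟩)
    (by rw [volume_pairWindow]; exact ENNReal.pow_ne_top measure_ball_lt_top.ne)
    (by rw [hb]; positivity) hT ?_ ((hne.product hne).image _) ?_ ?_
  · rw [Finset.card_image_of_injective _ (WithLp.toLp_injective 2), Finset.card_product, hb,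
      volume_real_pairWindow, ← hv] at hkey
    push_cast at hkey
    have hratio : volume.real (ball (0 : Rn n) R) = (R / (R + T)) ^ n * v := by
      rw [hv, volume_real_ball_of_pos hR0,
        volume_real_ball_of_pos (by positivity : 0 < R + T), div_pow]
      have : (R + T) ^ n ≠ 0 := by positivity
      field_simp
    have hM : M * (v ^ 2 - volume.real (ball (0 : Rn n) R) ^ 2) ≤ ε * v ^ 2 := by
      have := mul_le_mul_of_nonneg_right hR (sq_nonneg v)
      rw [hratio]
      refine le_trans (le_of_eq ?_) this
      ring
    have h1 : (A.card : ℝ) * A.card * (θ ^ 2 * v ^ 2) ≤ (v ^ 2) ^ 2 * f 0 := by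
      refine le_trans (mul_le_mul_of_nonneg_left ?_ (by positivity)) hkey
      simp only [ε] at hM ⊢
      linarith
    have h2 : (θ * A.card) ^ 2 ≤ v ^ 2 * f 0 := by
      refine le_of_mul_le_mul_right ?_ (by positivity : 0 < v ^ 2)
      linarith
    have h3 := Real.le_sqrt_of_sq_le h2
    rwa [Real.sqrt_mul (sq_nonneg v), Real.sqrt_sq hvpos.le] at h3
  · intro x hx y hy
    by_contra! hlt
    have h1 := WithLp.norm_fst_le (x := x - y)
    have h2 := WithLp.norm_snd_le (x := x - y)
    refine hy (mem_pairWindow.2 ⟨?_, ?_⟩)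
    · have := norm_le_norm_add_norm_sub x.fst y.fst
      rw [WithLp.sub_fst] at h1
      linarith [(mem_pairWindow.1 hx).1]
    · have := norm_le_norm_add_norm_sub x.snd y.snd
      rw [WithLp.sub_snd] at h2
      linarith [(mem_pairWindow.1 hx).2]
  · intro p hp
    obtain ⟨z, hz, rfl⟩ := Finset.mem_image.1 (Finset.mem_coe.1 hp)
    obtain ⟨h1, h2⟩ := Finset.mem_product.1 hz
    exact mem_pairWindow.2 ⟨mem_ball_zero_iff.1 (hA h1), mem_ball_zero_iff.1 (hA h2)⟩
  · intro p hp q hq hpq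
    obtain ⟨z, hz, rfl⟩ := Finset.mem_image.1 hp
    obtain ⟨w, hw, rfl⟩ := Finset.mem_image.1 hq
    obtain ⟨hz1, hz2⟩ := Finset.mem_product.1 hz
    obtain ⟨hw1, hw2⟩ := Finset.mem_product.1 hw
    exact hneg _ ⟨hS _ hz1 _ hw1 _ hz2 _ hw2, sub_ne_zero.2 hpq⟩

end PairWindow

/-! ### Lattice packings -/

section LatticePacking

open scoped Topology

variable {n : ℕ} {Λ : Submodule ℤ (Rn n)} {ρ : ℝ}

lemma IsLatticePacking.two_mul_radius_le_norm (h : IsLatticePacking n Λ ρ) {x : Rn n} (hx : x ∈ Λ)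
    (hx0 : x ≠ 0) : 2 * ρ ≤ ‖x‖ := by
  have := (disjoint_ball_ball_iff h.radius_pos h.radius_pos).1
    (h.disjoint (x := x) hx Λ.zero_mem hx0)
  rwa [dist_zero_right, ← two_mul] at this

lemma IsLatticePacking.finite_inter_ball (h : IsLatticePacking n Λ ρ) (R : ℝ) :
    ((Λ : Set (Rn n)) ∩ ball 0 R).Finite := by
  have : DiscreteTopology Λ.toAddSubgroup := h.discrete
  have hcl : IsClosed (Λ : Set (Rn n)) := Λ.toAddSubgroup.isClosed_of_discrete
  have : IsDiscrete (Λ : Set (Rn n)) := ⟨h.discrete⟩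
  rw [Set.inter_comm]
  exact Metric.finite_isBounded_inter_isClosed this isBounded_ball hcl

/-- Rescaling a lattice packing so that its minimal distance is at least `r` puts the pairs of
lattice vectors into `SLat n r`: their sums and differences are again lattice vectors. -/
lemma IsLatticePacking.smul_pair_mem_SLat (h : IsLatticePacking n Λ ρ) {r : ℝ} (hr : 0 < r)
    {x y : Rn n} (hx : x ∈ Λ) (hy : y ∈ Λ) :
    WithLp.toLp 2 ((r / (2 * ρ)) • x, (r / (2 * ρ)) • y) ∈ SLat n r := by
  have hρ := h.radius_pos
  have key : ∀ z ∈ Λ, ‖(r / (2 * ρ)) • z‖ ∈ ({0} ∪ Set.Ici r : Set ℝ) := by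
    intro z hz
    rcases eq_or_ne z 0 with rfl | hz0
    · simp
    · right
      rw [Set.mem_Ici, norm_smul, Real.norm_of_nonneg (by positivity), div_mul_eq_mul_div,
        le_div_iff₀ (by positivity)]
      exact mul_le_mul_of_nonneg_left (h.two_mul_radius_le_norm hz hz0) hr.le
  refine ⟨key x hx, key y hy, ?_, ?_⟩
  · have := key _ (Λ.add_mem hx hy)
    rwa [smul_add] at this
  · have := key _ (Λ.sub_mem hx hy)
    rwa [smul_sub] at this

lemma volume_packing_inter_ball_le (hfin : ∀ R, ((Λ : Set (Rn n)) ∩ ball 0 R).Finite)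
    (ρ R : ℝ) :
    volume ((⋃ x ∈ Λ, closedBall x ρ) ∩ ball 0 R) ≤
      (hfin (R + ρ)).toFinset.card * volume (closedBall (0 : Rn n) ρ) := by
  have hsub : (⋃ x ∈ Λ, closedBall x ρ) ∩ ball 0 R ⊆
      ⋃ x ∈ (hfin (R + ρ)).toFinset, closedBall x ρ := by
    rintro z ⟨hz, hzR⟩
    obtain ⟨x, hx, hzx⟩ := Set.mem_iUnion₂.1 hz
    refine Set.mem_iUnion₂.2 ⟨x, (Set.Finite.mem_toFinset _).2 ⟨hx, ?_⟩, hzx⟩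
    rw [mem_ball_zero_iff] at hzR ⊢
    rw [mem_closedBall, dist_comm, dist_eq_norm] at hzx
    linarith [norm_le_norm_add_norm_sub' x z]
  refine (measure_mono hsub).trans ((measure_biUnion_finset_le _ _).trans (le_of_eq ?_))
  simp only [Measure.addHaar_closedBall_center _ _ ρ, Finset.sum_const, nsmul_eq_mul]

/-- The density bound for one packing, up to a factor that tends to `1` as `θ → 1`. -/
lemma IsLatticePacking.upperDensity_le_mul (h : IsLatticePacking n Λ ρ) {r : ℝ} (hr : 0 < r)
    {f : RnPair n → ℝ} (hc : Continuous f) (hf : Integrable f)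
    (h0 : ∀ w, 0 ≤ (𝓕 (fun x => (f x : ℂ)) w).re ∧ (𝓕 (fun x => (f x : ℂ)) w).im = 0)
    (hone : ∫ x, f x = 1) (hneg : ∀ p ∈ SLat n r \ {0}, f p ≤ 0) {θ : ℝ} (hθ0 : 0 < θ)
    (hθ1 : θ < 1) :
    upperDensity n (⋃ x ∈ Λ, closedBall x ρ) ≤
      volume (closedBall (0 : Rn n) (r / 2)) * ENNReal.ofReal √(f 0) *
        ENNReal.ofReal (θ⁻¹ ^ (n + 1)) := by
  classical
  have hρ := h.radius_pos
  set s : ℝ := r / (2 * ρ) with hs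
  have hs0 : 0 < s := by positivity
  obtain ⟨T, hT⟩ := exists_mul_card_le hc hf h0 hone hneg hθ0 hθ1
  have hscale : Tendsto (fun R : ℝ => s * (R + ρ)) atTop atTop :=
    (tendsto_atTop_add_const_right atTop ρ tendsto_id).const_mul_atTop hs0
  -- the enlargement of the windows by constants is absorbed into a dilation by `θ⁻¹`
  have hdil : ∀ᶠ R : ℝ in atTop, s * (R + ρ) + T ≤ s / θ * R := by
    have hpos : 0 < s / θ - s := by
      rw [sub_pos, lt_div_iff₀ hθ0]
      nlinarith
    filter_upwards [(tendsto_id.const_mul_atTop hpos).eventually_ge_atTop (s * ρ + T)] with R hR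
    simp only [id] at hR
    linarith
  refine limsup_le_of_le (by isBoundedDefault) ?_
  filter_upwards [hscale.eventually hT, hdil, eventually_gt_atTop 0] with R hR hRT hR0
  set F := (h.finite_inter_ball (R + ρ)).toFinset
  have hinj : Function.Injective fun x : Rn n => s • x := smul_right_injective _ hs0.ne'
  have hcard := hR (F.image fun x => s • x) ?_ ?_
  · rw [Finset.card_image_of_injective _ hinj] at hcard
    have hball : volume.real (ball (0 : Rn n) (s * (R + ρ) + T)) ≤
        (s / θ) ^ n * volume.real (ball (0 : Rn n) R) := by
      refine (measureReal_mono (ball_subset_ball hRT) measure_ball_lt_top.ne).trans (le_of_eq ?_)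
      rw [volume_real_ball_of_pos (by positivity), volume_real_ball_of_pos hR0]
      ring
    have hclosed : ∀ t : ℝ, 0 ≤ t → volume.real (closedBall (0 : Rn n) t) =
        t ^ n * volume.real (ball (0 : Rn n) 1) := fun t ht => by
      rw [measureReal_def, Measure.addHaar_closedBall _ _ ht, ENNReal.toReal_mul,
        ENNReal.toReal_ofReal (by positivity), finrank_euclideanSpace_fin, measureReal_def]
    have hreal : (F.card : ℝ) * volume.real (closedBall (0 : Rn n) ρ) ≤
        volume.real (closedBall (0 : Rn n) (r / 2)) * √(f 0) * θ⁻¹ ^ (n + 1) *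
          volume.real (ball (0 : Rn n) R) := by
      have h1 : θ * F.card ≤ (s / θ) ^ n * volume.real (ball (0 : Rn n) R) * √(f 0) :=
        hcard.trans (mul_le_mul_of_nonneg_right hball (Real.sqrt_nonneg _))
      have h2 : (F.card : ℝ) ≤
          θ⁻¹ * ((s / θ) ^ n * volume.real (ball (0 : Rn n) R) * √(f 0)) := by
        rwa [inv_mul_eq_div, le_div_iff₀ hθ0, mul_comm]
      refine (mul_le_mul_of_nonneg_right h2 measureReal_nonneg).trans (le_of_eq ?_)
      have h3 : r / 2 = s * ρ := by rw [hs]; field_simp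
      rw [h3, hclosed _ hρ.le, hclosed _ (by positivity), div_pow, mul_pow, inv_pow]
      field_simp
      ring
    refine ENNReal.div_le_of_le_mul ((volume_packing_inter_ball_le h.finite_inter_ball ρ R).trans ?_)
    have h4 := ENNReal.ofReal_le_ofReal hreal
    rw [ENNReal.ofReal_mul (by positivity), ENNReal.ofReal_mul (by positivity),
      ENNReal.ofReal_mul (by positivity), ENNReal.ofReal_mul (by positivity),
      ofReal_measureReal measure_closedBall_lt_top.ne,
      ofReal_measureReal measure_closedBall_lt_top.ne, ofReal_measureReal measure_ball_lt_top.ne,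
      ENNReal.ofReal_natCast] at h4
    exact h4
  · intro z hz
    obtain ⟨x, hx, rfl⟩ := Finset.mem_image.1 (Finset.mem_coe.1 hz)
    have hx' := ((Set.Finite.mem_toFinset _).1 hx).2
    rw [mem_ball_zero_iff] at hx' ⊢
    rw [norm_smul, Real.norm_of_nonneg hs0.le]
    exact mul_lt_mul_of_pos_left hx' hs0
  · simp only [Finset.forall_mem_image]
    have hmem : ∀ {x}, x ∈ F → x ∈ Λ := fun hx => ((Set.Finite.mem_toFinset _).1 hx).1
    intro x hx x' hx' y hy y' hy'
    rw [← smul_sub, ← smul_sub]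
    exact h.smul_pair_mem_SLat hr (Λ.sub_mem (hmem hx) (hmem hx'))
      (Λ.sub_mem (hmem hy) (hmem hy'))

end LatticePacking

theorem theorem1p4 (n : ℕ) (r : ℝ) (hr : 0 < r) (f : RnPair n → ℝ)
    (hcont : Continuous f) (hint : Integrable f)
    (hnonneg : ∀ y : RnPair n,
      0 ≤ (𝓕 (fun p : RnPair n => (f p : ℂ)) y).re ∧ (𝓕 (fun p : RnPair n => (f p : ℂ)) y).im = 0)
    (hone : 𝓕 (fun p : RnPair n => (f p : ℂ)) 0 = 1)
    (hneg : ∀ p ∈ SLat n r \ {0}, f p ≤ 0) :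
    latticePackingDensity n ≤
      volume (closedBall (0 : Rn n) (r / 2)) * ENNReal.ofReal (Real.sqrt (f 0)) := by
  have hmass : ∫ x, f x = 1 := by
    have h1 : ∫ x, (f x : ℂ) = 1 := by simpa [Real.fourier_eq'] using hone
    rw [integral_complex_ofReal] at h1
    exact_mod_cast h1
  refine iSup_le fun Λ => iSup_le fun ρ => iSup_le fun h => ?_
  have hlim : Tendsto (fun θ : ℝ => volume (closedBall (0 : Rn n) (r / 2)) *
      ENNReal.ofReal √(f 0) * ENNReal.ofReal (θ⁻¹ ^ (n + 1))) (nhdsWithin 1 (Set.Iio 1))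
      (nhds (volume (closedBall (0 : Rn n) (r / 2)) * ENNReal.ofReal √(f 0) *
        ENNReal.ofReal ((1 : ℝ)⁻¹ ^ (n + 1)))) := by
    refine ENNReal.Tendsto.const_mul (ENNReal.tendsto_ofReal ?_)
      (Or.inr (ENNReal.mul_ne_top measure_closedBall_lt_top.ne ENNReal.ofReal_ne_top))
    exact ((tendsto_inv₀ one_ne_zero).mono_left nhdsWithin_le_nhds).pow (n + 1)
  rw [inv_one, one_pow, ENNReal.ofReal_one, mul_one] at hlim
  refine ge_of_tendsto hlim ?_
  filter_upwards [self_mem_nhdsWithin, nhdsWithin_le_nhds (lt_mem_nhds one_pos)] with θ h1 h0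
  exact h.upperDensity_le_mul hr hcont hint hnonneg hmass hneg h0 h1
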